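/- Let $\mathbb{F}$ be an algebraically closed field with $\operatorname{char}(\mathbb{F})\neq 2$ and let $n\ge 0$ be an integer. A representation of degree $n$ of a group $G$ is a homomorphism $\rho:G\to GL(V)$ with $V$ an $n$-dimensional $\mathbb{F}$-vector space; representations are counted up to isomorphism. A bilinear form $B$ on $V$ is invariant under $\rho$ if $B(\rho(g)x,\rho(g)y)=B(x,y)$ for all $g\in G$ and $x,y\in V$. (1) For $G=D_4$ (the dihedral group of order $8$) and for $G=Q_8$ (the quaternion group of order $8$), the number of isomorphism classes of representations of $G$ of degree $n$ over $\mathbb{F}$ that admit a non-degenerate invariant bilinear form is $$\sum_{s=0}^{\lfloor n/2\rfloor}\binom{n-2s+3}{3}.$$ (2) For $G=\mathbb{Z}_2\times\mathbb{Z}_2\times\mathbb{Z}_2$, the number of isomorphism classes of representations of $G$ of degree $n$ over $\mathbb{F}$ that admit a non-degenerate invariant bilinear form is $\binom{n+7}{7}$. For each of these three groups this number equals the number of all isomorphism classes of representations of $G$ of degree $n$ over $\mathbb{F}$. -/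

import Mathlib

universe u v w

section Forms

variable {F : Type u} {G : Type*} [Field F] [Group G]
  {V : Type v} [AddCommGroup V] [Module F V] {W : Type w} [AddCommGroup W] [Module F W]

/-- The space of bilinear forms `B` on `V` that are invariant under `ρ`:
`B (ρ g x) (ρ g y) = B x y` for all `g`, `x`, `y`. -/
def invariantForms (ρ : Representation F G V) : Submodule F (LinearMap.BilinForm F V) where
  carrier := {B | ∀ (g : G) (x y : V), B (ρ g x) (ρ g y) = B x y}
  zero_mem' := by intro g x y; simp
  add_mem' := by
    intro B C hB hC g x y
    simp only [LinearMap.add_apply]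
    rw [hB g x y, hC g x y]
  smul_mem' := by
    intro c B hB g x y
    simp only [LinearMap.smul_apply]
    rw [hB g x y]

/-- The space of invariant bilinear forms of `ρ` contains a non-degenerate form. -/
def AdmitsNondegenerateForm (ρ : Representation F G V) : Prop :=
  ∃ B ∈ invariantForms ρ, B.Nondegenerate

/-- Admitting a non-degenerate invariant form is inherited along isomorphisms. -/
theorem AdmitsNondegenerateForm.of_equiv {ρ : Representation F G V} {σ : Representation F G W}
    (e : ρ.Equiv σ) (h : AdmitsNondegenerateForm ρ) : AdmitsNondegenerateForm σ := by
  obtain ⟨B, hB, hnd⟩ := h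
  refine ⟨LinearMap.BilinForm.congr e.toLinearEquiv B, ?_, hnd.congr _⟩
  intro g x y
  have key : ∀ z : W, e.toLinearEquiv.symm (σ g z) = ρ g (e.toLinearEquiv.symm z) := by
    intro z
    rw [LinearEquiv.symm_apply_eq]
    have := LinearMap.congr_fun (e.isIntertwining' g) (e.toLinearEquiv.symm z)
    simp only [LinearMap.comp_apply] at this
    have h2 : e.toLinearEquiv (ρ g (e.toLinearEquiv.symm z))
        = σ g (e.toLinearEquiv (e.toLinearEquiv.symm z)) := this
    rw [h2, LinearEquiv.apply_symm_apply]
  simp only [LinearMap.BilinForm.congr_apply, key]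
  exact hB g _ _

end Forms

section Classes

/-- Isomorphism of representations of `G` on `F ^ n`. -/
def repSetoid (F : Type u) [Field F] (G : Type v) [Group G] (n : ℕ) :
    Setoid (Representation F G (Fin n → F)) where
  r ρ σ := Nonempty (ρ.Equiv σ)
  iseqv :=
    ⟨fun ρ => ⟨Representation.Equiv.refl ρ⟩, fun ⟨e⟩ => ⟨e.symm⟩, fun ⟨e⟩ ⟨f⟩ => ⟨e.trans f⟩⟩

/-- The isomorphism classes of representations of `G` over `F` of degree `n`. Every representation
on an `n`-dimensional space is isomorphic to one on `F ^ n`: see `exists_equiv_of_finrank_eq`. -/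
def RepClass (F : Type u) [Field F] (G : Type v) [Group G] (n : ℕ) : Type (max u v) :=
  Quotient (repSetoid F G n)

/-- The representations in the class admit a non-degenerate invariant bilinear form. -/
def RepClass.AdmitsNondegenerateForm {F : Type u} [Field F] {G : Type v} [Group G] {n : ℕ}
    (c : RepClass F G n) : Prop :=
  Quotient.lift (s := repSetoid F G n) (fun ρ => _root_.AdmitsNondegenerateForm ρ)
    (fun _ _ ⟨e⟩ => propext ⟨fun h => h.of_equiv e, fun h => h.of_equiv e.symm⟩) c

/-- Every representation of degree `n` is isomorphic to a representation on `F ^ n`. -/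
theorem exists_equiv_of_finrank_eq {F : Type u} [Field F] {G : Type v} [Group G] {n : ℕ}
    {V : Type w} [AddCommGroup V] [Module F V] [FiniteDimensional F V]
    (hV : Module.finrank F V = n) (ρ : Representation F G V) :
    ∃ σ : Representation F G (Fin n → F), Nonempty (ρ.Equiv σ) := by
  let e : V ≃ₗ[F] (Fin n → F) := LinearEquiv.ofFinrankEq V (Fin n → F) (by simp [hV])
  refine ⟨(e.conjRingEquiv : _ →* _).comp ρ, ⟨Representation.Equiv.mk e ?_⟩⟩
  intro g
  ext x
  simp [LinearEquiv.conjRingEquiv]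

end Classes

/-! The order 8 of each group is invertible in `F`, so by Maschke every representation is a direct
sum of irreducibles. As `F` is algebraically closed, Schur's lemma makes the multiplicity of an
irreducible `S i` equal to the dimension of the space of intertwining maps from `S i`. Isomorphism
classes of degree `n` therefore correspond to families `m` of naturals with `∑ i, m i * d i = n`,
where `d i` is the degree of `S i` (`IsCompleteIrreducible.natCard_repClass`).

Every irreducible here carries a non-degenerate invariant form. The characters take values ±1, so
multiplication on `F` is invariant. The plane of `D₄` or `Q₈` has the form `v₀w₁ ± v₁w₀`, symmetric
for `D₄` and alternating for `Q₈`. Orthogonal sums extend this to all representations, so the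
condition excludes nothing and only the counting of multiplicities remains.

`D₄` and `Q₈` have four characters and one plane. If the plane occurs `s` times, then `n - 2s` is
distributed over four characters, in `(n - 2s + 3).choose 3` ways. The elementary abelian group has
eight characters, which gives `(n + 7).choose 7`. -/

section Multiplicity

open Representation

variable {F : Type u} {G : Type v} [Field F] [Group G]

/-! ### Direct sums, their multiplicity spaces and their invariant forms -/

section Prod

variable {U V W : Type*} [AddCommGroup U] [Module F U] [AddCommGroup V] [Module F V]
  [AddCommGroup W] [Module F W]

/-- The multiplicity space of `τ` in a product is the product of the multiplicity spaces. -/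
noncomputable def Representation.intertwiningMapProdEquiv (τ : Representation F G U)
    (ρ : Representation F G V) (σ : Representation F G W) :
    IntertwiningMap τ (ρ.prod σ) ≃ₗ[F] IntertwiningMap τ ρ × IntertwiningMap τ σ where
  toFun f := ((IntertwiningMap.fst F ρ σ).comp f, (IntertwiningMap.snd F ρ σ).comp f)
  map_add' _ _ := rfl
  map_smul' _ _ := rfl
  invFun p := p.1.prod p.2
  left_inv _ := rfl
  right_inv _ := rfl

/-- Composition with an isomorphism of the target. -/
noncomputable def Representation.intertwiningMapCongrRight (τ : Representation F G U)
    {ρ : Representation F G V} {σ : Representation F G W} (e : ρ.Equiv σ) :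
    IntertwiningMap τ ρ ≃ₗ[F] IntertwiningMap τ σ where
  toFun f := e.toIntertwiningMap.comp f
  map_add' f g := DFunLike.ext _ _ fun x => map_add e (f x) (g x)
  map_smul' c f := DFunLike.ext _ _ fun x => map_smul e c (f x)
  invFun f := e.symm.toIntertwiningMap.comp f
  left_inv f := by
    apply DFunLike.ext; intro x
    exact e.symm_apply_apply (f x)
  right_inv f := by
    apply DFunLike.ext; intro x
    exact e.apply_symm_apply (f x)

/-- The product of two isomorphisms of representations. -/
noncomputable def Representation.Equiv.prodCongr {V' W' : Type*} [AddCommGroup V'] [Module F V']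
    [AddCommGroup W'] [Module F W'] {ρ : Representation F G V} {σ : Representation F G W}
    {ρ' : Representation F G V'} {σ' : Representation F G W'} (e : ρ.Equiv ρ') (f : σ.Equiv σ') :
    (ρ.prod σ).Equiv (ρ'.prod σ') :=
  Representation.Equiv.mk (e.toLinearEquiv.prodCongr f.toLinearEquiv) fun g =>
    LinearMap.ext fun x => Prod.ext (IntertwiningMap.isIntertwining _ _ e.toIntertwiningMap g x.1)
      (IntertwiningMap.isIntertwining _ _ f.toIntertwiningMap g x.2)

/-- The orthogonal sum of the two forms works: testing against `(y, 0)` and `(0, y)` recovers each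
summand. -/
theorem AdmitsNondegenerateForm.prod {ρ : Representation F G V} {σ : Representation F G W}
    (hρ : AdmitsNondegenerateForm ρ) (hσ : AdmitsNondegenerateForm σ) :
    AdmitsNondegenerateForm (ρ.prod σ) := by
  obtain ⟨B, hB, hBl, hBr⟩ := hρ
  obtain ⟨C, hC, hCl, hCr⟩ := hσ
  refine ⟨B.compl₁₂ (LinearMap.fst F V W) (LinearMap.fst F V W)
    + C.compl₁₂ (LinearMap.snd F V W) (LinearMap.snd F V W), ?_, ?_, ?_⟩
  · intro g x y
    have h1 := hB g x.1 y.1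
    have h2 := hC g x.2 y.2
    simp [h1, h2]
  · intro x hx
    refine Prod.ext (hBl _ fun y => ?_) (hCl _ fun y => ?_)
    · simpa using hx (y, 0)
    · simpa using hx (0, y)
  · intro x hx
    refine Prod.ext (hBr _ fun y => ?_) (hCr _ fun y => ?_)
    · simpa using hx (y, 0)
    · simpa using hx (0, y)

end Prod

theorem AdmitsNondegenerateForm.of_subsingleton {V : Type*} [AddCommGroup V] [Module F V]
    [Subsingleton V] (ρ : Representation F G V) : AdmitsNondegenerateForm ρ :=
  ⟨0, Submodule.zero_mem _, fun _ _ => Subsingleton.elim _ _, fun _ _ => Subsingleton.elim _ _⟩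

/-- A subrepresentation isomorphic to an irreducible `τ` splits off. -/
theorem Representation.exists_equiv_prod [Finite G] [NeZero (Nat.card G : F)]
    {U : Type*} [AddCommGroup U] [Module F U] [FiniteDimensional F U] {V : Type w} [AddCommGroup V]
    [Module F V] [FiniteDimensional F V] {τ : Representation F G U} [τ.IsIrreducible]
    {ρ : Representation F G V} {f : IntertwiningMap τ ρ} (hf : f ≠ 0) :
    ∃ (W : Submodule F V) (σ : Representation F G W), Nonempty ((τ.prod σ).Equiv ρ) := by
  have hinj : Function.Injective f := (IsIrreducible.injective_or_eq_zero f).resolve_right hf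
  -- Maschke's theorem: the range of `f` has an invariant complement.
  obtain ⟨Q, hQ⟩ := exists_isCompl f.range
  refine ⟨Q.toSubmodule, Q.toRepresentation, ⟨IntertwiningMap.ofBijective
    ⟨f.toLinearMap.coprod Q.toSubmodule.subtype, fun g => ?_⟩ ⟨?_, ?_⟩⟩⟩
  · refine LinearMap.ext fun x => ?_
    have := IntertwiningMap.isIntertwining _ _ f g x.1
    simp only [LinearMap.comp_apply, LinearMap.coprod_apply, map_add]
    exact congrArg₂ (· + ·) this rfl
  · rw [IntertwiningMap.coe_mk, ← LinearMap.ker_eq_bot]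
    refine (LinearMap.ker_eq_bot').2 fun x hx => ?_
    have hx' : f x.1 + (x.2 : V) = 0 := hx
    have h1 : (x.2 : V) ∈ f.range ⊓ Q := by
      refine ⟨?_, x.2.2⟩
      rw [eq_neg_of_add_eq_zero_right hx', ← map_neg]
      exact ⟨-x.1, rfl⟩
    rw [hQ.inf_eq_bot] at h1
    have h2 : (x.2 : V) = 0 := h1
    refine Prod.ext (hinj ?_) (Subtype.ext h2)
    rw [h2, add_zero] at hx'
    rw [hx']; exact (map_zero f).symm
  · intro v
    have hv : v ∈ (f.range ⊔ Q).toSubmodule := by rw [hQ.sup_eq_top]; trivial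
    rw [Subrepresentation.toSubmodule_sup] at hv
    obtain ⟨_, ⟨y, rfl⟩, z, hz, rfl⟩ := Submodule.mem_sup.1 hv
    exact ⟨(y, ⟨z, hz⟩), rfl⟩

/-- The `S i` are irreducible, pairwise non-isomorphic, and every nonzero finite-dimensional
representation contains one of them. -/
structure IsCompleteIrreducible {ι : Type*} {d : ι → ℕ}
    (S : ∀ i, Representation F G (Fin (d i) → F)) : Prop where
  irreducible : ∀ i, (S i).IsIrreducible
  eq_of_equiv : ∀ i j, Nonempty ((S i).Equiv (S j)) → i = j
  exists_ne_zero : ∀ (V : Type u) [AddCommGroup V] [Module F V] [FiniteDimensional F V]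
    [Nontrivial V] (ρ : Representation F G V), ∃ i, ∃ f : IntertwiningMap (S i) ρ, f ≠ 0

/-! ### Multiplicities as a complete isomorphism invariant -/

namespace IsCompleteIrreducible

variable {ι : Type*} {d : ι → ℕ} {S : ∀ i, Representation F G (Fin (d i) → F)}

theorem dim_pos (hS : IsCompleteIrreducible S) (i : ι) : 0 < d i := by
  have := (hS.irreducible i).toNontrivial
  by_contra h
  have h0 : d i = 0 := by omega
  have : IsEmpty (Fin (d i)) := by rw [h0]; infer_instance
  obtain ⟨p, q, hpq⟩ := exists_pair_ne (Subrepresentation (S i))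
  exact hpq (Subrepresentation.toSubmodule_injective (Subsingleton.elim _ _))

variable [IsAlgClosed F]

-- Schur's lemma, with algebraic closedness giving dimension one on the diagonal.
open Classical in
theorem finrank_intertwiningMap (hS : IsCompleteIrreducible S) (i j : ι) :
    Module.finrank F (IntertwiningMap (S i) (S j)) = if i = j then 1 else 0 := by
  have := hS.irreducible i
  have := hS.irreducible j
  split_ifs with h
  · subst h
    exact IsIrreducible.finrank_intertwiningMap_self (S i)
  · have : IsEmpty ((S i).Equiv (S j)) := ⟨fun e => h (hS.eq_of_equiv i j ⟨e⟩)⟩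
    exact Module.finrank_zero_of_subsingleton

open Classical in
theorem finrank_intertwiningMap_prod (hS : IsCompleteIrreducible S) (i j : ι) {V W : Type*}
    [AddCommGroup V] [Module F V] [AddCommGroup W] [Module F W] [FiniteDimensional F W]
    {ρ : Representation F G V} {σ : Representation F G W} (e : ((S j).prod σ).Equiv ρ) :
    Module.finrank F (IntertwiningMap (S i) ρ)
      = (if i = j then 1 else 0) + Module.finrank F (IntertwiningMap (S i) σ) := by
  rw [← (intertwiningMapCongrRight (S i) e).finrank_eq,
    (intertwiningMapProdEquiv (S i) (S j) σ).finrank_eq, Module.finrank_prod,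
    hS.finrank_intertwiningMap]

omit [IsAlgClosed F] in
theorem finrank_of_equiv_prod (j : ι) {V W : Type*}
    [AddCommGroup V] [Module F V] [AddCommGroup W] [Module F W] [FiniteDimensional F W]
    {ρ : Representation F G V} {σ : Representation F G W} (e : ((S j).prod σ).Equiv ρ) :
    Module.finrank F V = d j + Module.finrank F W := by
  rw [← e.toLinearEquiv.finrank_eq, Module.finrank_prod, Module.finrank_fin_fun]

variable [Finite G] [NeZero (Nat.card G : F)]

omit [IsAlgClosed F] in
/-- Isomorphism-invariant properties can be proved by adding one irreducible at a time. -/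
theorem induction (hS : IsCompleteIrreducible S)
    {P : ∀ (V : Type u) [AddCommGroup V] [Module F V], Representation F G V → Prop}
    (zero : ∀ (V : Type u) [AddCommGroup V] [Module F V] [Subsingleton V]
      (ρ : Representation F G V), P V ρ)
    (prod : ∀ (j : ι) (V W : Type u) [AddCommGroup V] [Module F V] [FiniteDimensional F V]
      [AddCommGroup W] [Module F W] [FiniteDimensional F W] (ρ : Representation F G V)
      (σ : Representation F G W), ((S j).prod σ).Equiv ρ → P W σ → P V ρ)
    (V : Type u) [AddCommGroup V] [Module F V] [FiniteDimensional F V]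
    (ρ : Representation F G V) : P V ρ := by
  induction hn : Module.finrank F V using Nat.strong_induction_on generalizing V with
  | _ n ih =>
    subst hn
    rcases subsingleton_or_nontrivial V with _ | _
    · exact zero V ρ
    · obtain ⟨j, f, hf⟩ := hS.exists_ne_zero V ρ
      have := hS.irreducible j
      obtain ⟨W, σ, ⟨e⟩⟩ := exists_equiv_prod hf
      have hd := finrank_of_equiv_prod j e
      -- Positivity of `d j` makes the complement `W` strictly smaller than `V`.
      have hj := hS.dim_pos j
      exact prod j V W ρ σ e (ih _ (by omega) W σ rfl)

theorem sum_finrank_mul [Fintype ι] (hS : IsCompleteIrreducible S) (V : Type u)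
    [AddCommGroup V] [Module F V] [FiniteDimensional F V] (ρ : Representation F G V) :
    ∑ i, Module.finrank F (IntertwiningMap (S i) ρ) * d i = Module.finrank F V := by
  refine hS.induction
    (P := fun V _ _ ρ => ∑ i, Module.finrank F (IntertwiningMap (S i) ρ) * d i
      = Module.finrank F V) ?_ ?_ V ρ
  · intro V _ _ _ ρ
    have h : ∀ i, Module.finrank F (IntertwiningMap (S i) ρ) = 0 := fun i => by
      have : Subsingleton (IntertwiningMap (S i) ρ) :=
        ⟨fun f g => DFunLike.ext _ _ fun _ => Subsingleton.elim _ _⟩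
      exact Module.finrank_zero_of_subsingleton
    simp [h, Module.finrank_zero_of_subsingleton]
  · intro j V W _ _ _ _ _ _ ρ σ e ih
    classical
    rw [finrank_of_equiv_prod j e, ← ih]
    simp_rw [hS.finrank_intertwiningMap_prod _ j e, add_mul, Finset.sum_add_distrib]
    simp

/-- Multiplicities determine a representation up to isomorphism. -/
theorem nonempty_equiv (hS : IsCompleteIrreducible S) (V W : Type u)
    [AddCommGroup V] [Module F V] [FiniteDimensional F V] (ρ : Representation F G V)
    [AddCommGroup W] [Module F W] [FiniteDimensional F W] (σ : Representation F G W)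
    (h : ∀ i, Module.finrank F (IntertwiningMap (S i) ρ)
      = Module.finrank F (IntertwiningMap (S i) σ)) : Nonempty (ρ.Equiv σ) := by
  refine hS.induction (P := fun V _ _ ρ => ∀ (W : Type u) [AddCommGroup W] [Module F W]
    [FiniteDimensional F W] (σ : Representation F G W),
      (∀ i, Module.finrank F (IntertwiningMap (S i) ρ)
        = Module.finrank F (IntertwiningMap (S i) σ)) → Nonempty (ρ.Equiv σ)) ?_ ?_ V ρ W σ h
  · intro V _ _ _ ρ W _ _ _ σ h
    rcases subsingleton_or_nontrivial W with _ | _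
    · exact ⟨Representation.Equiv.mk (0 : V ≃ₗ[F] W)
        fun g => LinearMap.ext fun x => Subsingleton.elim _ _⟩
    -- A nonzero `σ` would contain some `S i`, whose multiplicity in the zero representation is 0.
    · obtain ⟨i, f, hf⟩ := hS.exists_ne_zero W σ
      have h0 : Subsingleton (IntertwiningMap (S i) ρ) :=
        ⟨fun f g => DFunLike.ext _ _ fun _ => Subsingleton.elim _ _⟩
      have := h i
      rw [Module.finrank_zero_of_subsingleton, eq_comm, Module.finrank_zero_iff] at this
      exact absurd (Subsingleton.elim f 0) hf
  · intro j V V' _ _ _ _ _ _ ρ ρ' e ih W _ _ _ σ h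
    classical
    -- The summand `S j` of `ρ` also occurs in `σ`; it is cancelled from both sides before applying
    -- induction.
    have hpos : 0 < Module.finrank F (IntertwiningMap (S j) σ) := by
      rw [← h, hS.finrank_intertwiningMap_prod j j e, if_pos rfl]; omega
    have := Module.finrank_pos_iff.1 hpos
    obtain ⟨f, hf⟩ := exists_ne (0 : IntertwiningMap (S j) σ)
    have := hS.irreducible j
    obtain ⟨W', σ', ⟨e'⟩⟩ := exists_equiv_prod hf
    obtain ⟨e''⟩ := ih W' σ' fun i => by
      have := h i
      rw [hS.finrank_intertwiningMap_prod i j e, hS.finrank_intertwiningMap_prod i j e'] at this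
      omega
    exact ⟨e.symm.trans (((Representation.Equiv.refl (S j)).prodCongr e'').trans e')⟩

omit [IsAlgClosed F] in
theorem admitsNondegenerateForm (hS : IsCompleteIrreducible S)
    (hform : ∀ i, AdmitsNondegenerateForm (S i)) (V : Type u)
    [AddCommGroup V] [Module F V] [FiniteDimensional F V] (ρ : Representation F G V) :
    AdmitsNondegenerateForm ρ :=
  hS.induction (P := fun _ _ _ ρ => AdmitsNondegenerateForm ρ)
    (fun _ _ _ _ ρ => .of_subsingleton ρ)
    (fun j _ _ _ _ _ _ _ _ _ _ e ih => ((hform j).prod ih).of_equiv e) V ρ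

omit [Finite G] [NeZero (Nat.card G : F)] in
/-- Every family of multiplicities is realized. -/
theorem exists_representation [Fintype ι] (hS : IsCompleteIrreducible S) (m : ι → ℕ) :
    ∃ (V : Type u) (_ : AddCommGroup V) (_ : Module F V) (_ : FiniteDimensional F V)
      (ρ : Representation F G V), ∀ i, Module.finrank F (IntertwiningMap (S i) ρ) = m i := by
  classical
  induction hn : ∑ i, m i generalizing m with
  | zero =>
    refine ⟨PUnit, inferInstance, inferInstance, inferInstance, 1, fun i => ?_⟩
    have : Subsingleton (IntertwiningMap (S i) (1 : Representation F G PUnit.{u+1})) :=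
      ⟨fun f g => DFunLike.ext _ _ fun _ => Subsingleton.elim _ _⟩
    rw [Module.finrank_zero_of_subsingleton]
    exact ((Finset.sum_eq_zero_iff.1 hn) i (Finset.mem_univ i)).symm
  | succ n ih =>
    obtain ⟨j, -, hj⟩ : ∃ j ∈ Finset.univ, m j ≠ 0 :=
      Finset.exists_ne_zero_of_sum_ne_zero (by omega)
    -- Truncated subtraction is harmless because `m j ≠ 0`.
    have hm : m = Pi.single j 1 + (m - Pi.single j 1) := by
      funext i
      rcases eq_or_ne i j with rfl | h
      · simp; omega
      · simp [h]
    obtain ⟨V, _, _, _, ρ, hρ⟩ := ih (m - Pi.single j 1) (by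
      have h2 := congrArg (fun f : ι → ℕ => ∑ i, f i) hm
      simp only [Pi.add_apply, Finset.sum_add_distrib, Finset.sum_pi_single', Finset.mem_univ,
        if_true] at h2
      have h3 : ∑ i, (Pi.single j 1 : ι → ℕ) i = 1 := by simp
      omega)
    refine ⟨(Fin (d j) → F) × V, inferInstance, inferInstance, inferInstance, (S j).prod ρ,
      fun i => ?_⟩
    rw [hS.finrank_intertwiningMap_prod i j (.refl _), hρ, hm]
    simp [Pi.single_apply]

/-- Isomorphism classes of degree `n` correspond to families of multiplicities of total
degree `n`. -/
theorem natCard_repClass [Fintype ι] (hS : IsCompleteIrreducible S) (n : ℕ) :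
    Nat.card (RepClass F G n) = Nat.card {m : ι → ℕ // ∑ i, m i * d i = n} := by
  let φ : RepClass F G n → {m : ι → ℕ // ∑ i, m i * d i = n} :=
    Quotient.lift (s := repSetoid F G n)
      (fun ρ => ⟨fun i => Module.finrank F (IntertwiningMap (S i) ρ), by
        rw [hS.sum_finrank_mul, Module.finrank_fin_fun]⟩)
      (fun ρ σ ⟨e⟩ => Subtype.ext (funext fun i =>
        (intertwiningMapCongrRight (S i) e).finrank_eq))
  refine Nat.card_congr (Equiv.ofBijective φ ⟨?_, ?_⟩)
  · intro a b
    induction a using Quotient.inductionOn with | _ ρ =>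
    induction b using Quotient.inductionOn with | _ σ =>
    intro h
    exact Quotient.sound (s := repSetoid F G n)
      (hS.nonempty_equiv _ _ ρ σ (congrFun (Subtype.ext_iff.1 h)))
  · rintro ⟨m, hm⟩
    obtain ⟨V, _, _, _, ρ, hρ⟩ := hS.exists_representation m
    have hV : Module.finrank F V = n := by
      rw [← hS.sum_finrank_mul V ρ, ← hm]
      simp_rw [hρ]
    obtain ⟨σ, ⟨e⟩⟩ := exists_equiv_of_finrank_eq hV ρ
    refine ⟨Quotient.mk (repSetoid F G n) σ, Subtype.ext (funext fun i => ?_)⟩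
    exact (intertwiningMapCongrRight (S i) e).finrank_eq.symm.trans (hρ i)

omit [IsAlgClosed F] in
theorem natCard_admitsNondegenerateForm (hS : IsCompleteIrreducible S)
    (hform : ∀ i, AdmitsNondegenerateForm (S i)) (n : ℕ) :
    Nat.card {c : RepClass F G n // c.AdmitsNondegenerateForm} = Nat.card (RepClass F G n) :=
  Nat.card_congr (Equiv.subtypeUnivEquiv fun c => by
    induction c using Quotient.inductionOn with | _ ρ =>
    exact hS.admitsNondegenerateForm hform _ ρ)

end IsCompleteIrreducible

end Multiplicity

/-! ### Characters and finite commutative groups -/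

section Characters

open Representation

variable {F : Type u} {G : Type v} [Field F]

/-- The one-dimensional representation given by a character. -/
noncomputable def charRep [Group G] (χ : G →* F) : Representation F G (Fin 1 → F) :=
  (algebraMap F (Module.End F (Fin 1 → F)) : F →* Module.End F (Fin 1 → F)).comp χ

section Group

variable [Group G]

@[simp]
theorem charRep_apply (χ : G →* F) (g : G) (v : Fin 1 → F) : charRep χ g v = χ g • v := rfl

theorem charRep_isIrreducible (χ : G →* F) : (charRep χ).IsIrreducible := by
  have h1 : IsSimpleModule F (Fin 1 → F) := isSimpleModule_iff_finrank_eq_one.2 (by simp)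
  refine { exists_pair_ne := ⟨⊥, ⊤, fun h => ?_⟩, eq_bot_or_eq_top := fun N => ?_ }
  · exact bot_ne_top (α := Submodule F (Fin 1 → F)) (congrArg Subrepresentation.toSubmodule h)
  · exact (eq_bot_or_eq_top N.toSubmodule).imp
      (fun h => Subrepresentation.toSubmodule_injective h)
      (fun h => Subrepresentation.toSubmodule_injective h)

theorem eq_of_charRep_equiv {χ ψ : G →* F} (e : (charRep χ).Equiv (charRep ψ)) : χ = ψ := by
  ext g
  have h := IntertwiningMap.isIntertwining _ _ e.toIntertwiningMap g 1
  have h0 : e.toLinearEquiv 1 ≠ 0 := by simp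
  rw [charRep_apply, charRep_apply, map_smul] at h
  exact smul_left_injective F h0 h

theorem charRep_admitsNondegenerateForm {χ : G →* F} (hχ : ∀ g, χ g * χ g = 1) :
    AdmitsNondegenerateForm (charRep χ) := by
  refine ⟨(LinearMap.mul F F).compl₁₂ (LinearMap.proj 0) (LinearMap.proj 0), ?_, ?_, ?_⟩
  · intro g x y
    simp only [LinearMap.compl₁₂_apply, charRep_apply, LinearMap.proj_apply, LinearMap.mul_apply',
      Pi.smul_apply, smul_eq_mul]
    linear_combination x 0 * y 0 * hχ g
  · intro x hx
    funext i
    simpa [Subsingleton.elim i 0] using hx 1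
  · intro x hx
    funext i
    simpa [Subsingleton.elim i 0] using hx 1

/-- A common eigenvector spans a copy of `charRep χ`. -/
theorem exists_charRep_intertwiningMap_ne_zero {V : Type*} [AddCommGroup V] [Module F V]
    (ρ : Representation F G V) (χ : G →* F) {v : V} (hv : v ≠ 0) (h : ∀ g, ρ g v = χ g • v) :
    ∃ f : IntertwiningMap (charRep χ) ρ, f ≠ 0 := by
  refine ⟨⟨(LinearMap.toSpanSingleton F V v).comp (LinearMap.proj 0), fun g => ?_⟩, fun hf => ?_⟩
  · ext
    simp [h, smul_smul, mul_comm]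
  · have := DFunLike.congr_fun hf (1 : Fin 1 → F)
    exact hv (by simpa using this)

end Group

variable [CommGroup G] [Finite G] [IsAlgClosed F] [NeZero (Nat.card G : F)]

/-- A simple submodule over the commutative group algebra is one-dimensional when `F` is
algebraically closed; a spanning vector is a common eigenvector, and its eigenvalues form the
character. -/
theorem exists_common_eigenvector {V : Type*} [AddCommGroup V] [Module F V]
    [FiniteDimensional F V] [Nontrivial V] (ρ : Representation F G V) :
    ∃ (χ : G →* Fˣ) (v : V), v ≠ 0 ∧ ∀ g, ρ g v = (χ g : F) • v := by
  have : Nontrivial ρ.asModule := ‹Nontrivial V›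
  have : FiniteDimensional F ρ.asModule := ‹FiniteDimensional F V›
  obtain ⟨m, hm⟩ := IsSemisimpleModule.exists_simple_submodule (MonoidAlgebra F G) ρ.asModule
  let m' : Submodule F V := (Subrepresentation.ofSubmodule' m).toSubmodule
  have : FiniteDimensional F m := inferInstanceAs (FiniteDimensional F m')
  have h1 : Module.finrank F m' = 1 :=
    IsSimpleModule.finrank_eq_one_of_isMulCommutative (MonoidAlgebra F G) m F
  obtain ⟨v, hv, hspan⟩ := finrank_eq_one_iff'.1 h1
  have hv' : (v : V) ≠ 0 := fun h => hv (Subtype.ext h)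
  have key : ∀ g, ∃ c : F, ρ g v = c • (v : V) := fun g => by
    obtain ⟨c, hc⟩ := hspan ⟨ρ g v, (Subrepresentation.ofSubmodule' m).apply_mem_toSubmodule g v.2⟩
    exact ⟨c, (congrArg Subtype.val hc).symm⟩
  choose c hc using key
  let χ : G →* F :=
    { toFun := c
      map_one' := smul_left_injective F hv' (by
        change c 1 • (v : V) = (1 : F) • (v : V)
        rw [← hc]; simp)
      map_mul' := fun g h => smul_left_injective F hv' (by
        change c (g * h) • (v : V) = (c g * c h) • (v : V)
        rw [← hc, map_mul, Module.End.mul_apply, hc h, map_smul, hc g, smul_smul, mul_comm]) }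
  exact ⟨χ.toHomUnits, v, hv', fun g => hc g⟩

/-- The characters of a finite commutative group are its irreducible representations. -/
theorem isCompleteIrreducible_charRep :
    IsCompleteIrreducible (d := fun _ => 1)
      (fun χ : G →* Fˣ => charRep ((Units.coeHom F).comp χ)) where
  irreducible _ := charRep_isIrreducible _
  eq_of_equiv χ ψ := fun ⟨e⟩ => by
    ext g
    exact DFunLike.congr_fun (eq_of_charRep_equiv e) g
  exists_ne_zero V _ _ _ _ ρ := by
    obtain ⟨χ, v, hv, h⟩ := exists_common_eigenvector ρ
    exact ⟨χ, exists_charRep_intertwiningMap_ne_zero ρ _ hv h⟩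

/-- Stars and bars: such families are multisets of size `n` in `ι`. -/
theorem natCard_sum_eq {ι : Type*} [Fintype ι] (n : ℕ) :
    Nat.card {m : ι → ℕ // ∑ i, m i = n} = (Fintype.card ι + n - 1).choose n := by
  classical
  rw [← Nat.card_congr (Sym.equivNatSumOfFintype ι n), Sym.natCard_sym_eq_choose,
    Nat.card_eq_fintype_card]

theorem natCard_repClass_of_commGroup (n : ℕ) :
    Nat.card (RepClass F G n) = (Nat.card G + n - 1).choose n := by
  -- The exponent divides the order, so it is invertible in `F`. Then `F` has enough roots of unity,
  -- and `G` has as many characters as elements.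
  have : NeZero (Monoid.exponent G : F) := by
    refine ⟨fun h => NeZero.ne (Nat.card G : F) ?_⟩
    obtain ⟨k, hk⟩ := Group.exponent_dvd_nat_card (G := G)
    rw [hk, Nat.cast_mul, h, zero_mul]
  have : Finite (G →* Fˣ) := inferInstance
  have := Fintype.ofFinite (G →* Fˣ)
  rw [isCompleteIrreducible_charRep.natCard_repClass]
  simp only [mul_one]
  rw [natCard_sum_eq, ← Nat.card_eq_fintype_card,
    CommGroup.card_monoidHom_of_hasEnoughRootsOfUnity G F]

theorem natCard_admitsNondegenerateForm_of_sq_eq_one (hG : ∀ g : G, g * g = 1) (n : ℕ) :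
    Nat.card {c : RepClass F G n // c.AdmitsNondegenerateForm} = Nat.card (RepClass F G n) :=
  isCompleteIrreducible_charRep.natCard_admitsNondegenerateForm (fun χ =>
    charRep_admitsNondegenerateForm fun g => by rw [← map_mul, hG, map_one]) n

end Characters

/-! ### The dihedral and quaternion groups through one presentation -/

section OrderEight

open Representation

/-- `G` has the presentation `⟨a, x | a ^ 4 = 1, x ^ 2 = a ^ (2 * e), a x = x a ^ 3⟩`: it is
dihedral of order eight when `e` is even and quaternion when `e` is odd. -/
structure HasOrderEightPresentation.{l, m} {G : Type m} [Group G] (a x : G) (e : ℕ) : Prop where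
  pow_four : a ^ 4 = 1
  mul_self : x * x = a ^ (2 * e)
  mul_eq : a * x = x * a ^ 3
  -- Generation as a monoid spares inverses in inductions on words. In the universal property below,
  -- monoid targets allow direct lifts to `F` and to endomorphism monoids.
  closure_eq_top : Submonoid.closure {a, x} = ⊤
  lift : ∀ {M : Type l} [Monoid M] (A X : M), A ^ 4 = 1 → X * X = A ^ (2 * e) → A * X = X * A ^ 3 →
    ∃ φ : G →* M, φ a = A ∧ φ x = X

section Lift

variable {M : Type*} [Monoid M] {A X : M}

theorem pow_mul_of_mul_eq (h : A * X = X * A ^ 3) (i : ℕ) : A ^ i * X = X * A ^ (3 * i) := by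
  induction i with
  | zero => simp
  | succ i ih => rw [pow_succ, mul_assoc, h, ← mul_assoc, ih, mul_assoc, ← pow_add]; congr 2

/-- Moving `X` to the left brings products to the normal form `X * A ^ k` used in both lifts below.
-/
theorem pow_mul_mul_pow_of_mul_eq (h : A * X = X * A ^ 3) (i j : ℕ) :
    A ^ i * (X * A ^ j) = X * A ^ (3 * i + j) := by
  rw [← mul_assoc, pow_mul_of_mul_eq h, mul_assoc, ← pow_add]

theorem pow_eq_pow_of_mod_eq (h : A ^ 4 = 1) {i j : ℕ} (hij : i % 4 = j % 4) : A ^ i = A ^ j := by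
  rw [pow_eq_pow_mod i h, pow_eq_pow_mod j h, hij]

/-- The homomorphism from `DihedralGroup 4` with prescribed values on the generators. -/
def dihedralGroupLift (hA : A ^ 4 = 1) (hX : X * X = A ^ (2 * 0)) (hAX : A * X = X * A ^ 3) :
    DihedralGroup 4 →* M where
  toFun
    | .r i => A ^ i.val
    | .sr i => X * A ^ i.val
  map_one' := pow_zero A
  map_mul' := by
    rintro (i | i) (j | j)
    · change A ^ (i + j).val = A ^ i.val * A ^ j.val
      rw [← pow_add]
      exact pow_eq_pow_of_mod_eq hA (by decide +revert)
    -- Since `3 ≡ -1` modulo 4, the exponent `3 * i + j` represents `j - i`.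
    · change X * A ^ (j - i).val = A ^ i.val * (X * A ^ j.val)
      rw [pow_mul_mul_pow_of_mul_eq hAX]
      exact congrArg (X * ·) (pow_eq_pow_of_mod_eq hA (by decide +revert))
    · change X * A ^ (i + j).val = X * A ^ i.val * A ^ j.val
      rw [mul_assoc, ← pow_add]
      exact congrArg (X * ·) (pow_eq_pow_of_mod_eq hA (by decide +revert))
    · change A ^ (j - i).val = X * A ^ i.val * (X * A ^ j.val)
      rw [mul_assoc, pow_mul_mul_pow_of_mul_eq hAX, ← mul_assoc, hX, ← pow_add]
      exact pow_eq_pow_of_mod_eq hA (by decide +revert)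

/-- The homomorphism from `QuaternionGroup 2` with prescribed values on the generators. -/
def quaternionGroupLift (hA : A ^ 4 = 1) (hX : X * X = A ^ (2 * 1)) (hAX : A * X = X * A ^ 3) :
    QuaternionGroup 2 →* M where
  toFun
    | .a i => A ^ i.val
    | .xa i => X * A ^ i.val
  map_one' := pow_zero A
  map_mul' := by
    rintro (i | i) (j | j)
    · change A ^ (i + j).val = A ^ i.val * A ^ j.val
      rw [← pow_add]
      exact pow_eq_pow_of_mod_eq hA (by decide +revert)
    · change X * A ^ (j - i).val = A ^ i.val * (X * A ^ j.val)
      rw [pow_mul_mul_pow_of_mul_eq hAX]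
      exact congrArg (X * ·) (pow_eq_pow_of_mod_eq hA (by decide +revert))
    · change X * A ^ (i + j).val = X * A ^ i.val * A ^ j.val
      rw [mul_assoc, ← pow_add]
      exact congrArg (X * ·) (pow_eq_pow_of_mod_eq hA (by decide +revert))
    -- The shift by 2, absent in the dihedral case, comes from `X * X = A ^ 2`.
    · change A ^ ((2 : ℕ) + j - i).val = X * A ^ i.val * (X * A ^ j.val)
      rw [mul_assoc, pow_mul_mul_pow_of_mul_eq hAX, ← mul_assoc, hX, ← pow_add]
      exact pow_eq_pow_of_mod_eq hA (by decide +revert)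

end Lift

theorem hasOrderEightPresentation_dihedralGroup :
    HasOrderEightPresentation.{u} (.r 1 : DihedralGroup 4) (.sr 0) 0 where
  pow_four := by decide
  mul_self := by decide
  mul_eq := by decide
  closure_eq_top := by
    have hr : ∀ i, .r i ∈ Submonoid.closure {(.r 1 : DihedralGroup 4), .sr 0} := fun i => by
      have h : (.r 1 : DihedralGroup 4) ∈ Submonoid.closure {.r 1, .sr 0} :=
        Submonoid.subset_closure (Set.mem_insert _ _)
      simpa using Submonoid.pow_mem _ h i.val
    rw [eq_top_iff]
    rintro (i | i) -
    · exact hr i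
    · have h : (.sr 0 : DihedralGroup 4) ∈ Submonoid.closure {.r 1, .sr 0} :=
        Submonoid.subset_closure (Set.mem_insert_of_mem _ rfl)
      simpa using Submonoid.mul_mem _ h (hr i)
  lift A X hA hX hAX := ⟨dihedralGroupLift hA hX hAX, pow_one A,
    (congrArg (X * ·) (pow_zero A)).trans (mul_one X)⟩

theorem hasOrderEightPresentation_quaternionGroup :
    HasOrderEightPresentation.{u} (.a 1 : QuaternionGroup 2) (.xa 0) 1 where
  pow_four := by decide
  mul_self := by decide
  mul_eq := by decide
  closure_eq_top := by
    have hr : ∀ i, .a i ∈ Submonoid.closure {(.a 1 : QuaternionGroup 2), .xa 0} := fun i => by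
      have h : (.a 1 : QuaternionGroup 2) ∈ Submonoid.closure {.a 1, .xa 0} :=
        Submonoid.subset_closure (Set.mem_insert _ _)
      simpa using Submonoid.pow_mem _ h i.val
    rw [eq_top_iff]
    rintro (i | i) -
    · exact hr i
    · have h : (.xa 0 : QuaternionGroup 2) ∈ Submonoid.closure {.a 1, .xa 0} :=
        Submonoid.subset_closure (Set.mem_insert_of_mem _ rfl)
      simpa using Submonoid.mul_mem _ h (hr i)
  lift A X hA hX hAX := ⟨quaternionGroupLift hA hX hAX, pow_one A,
    (congrArg (X * ·) (pow_zero A)).trans (mul_one X)⟩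

/-! ### Reduction to generators, signs and explicit endomorphisms -/

variable {F : Type u} {G : Type v} [Field F] [Group G] {a x : G} {e : ℕ}

theorem isIntertwining_of_generators (h : Submonoid.closure {a, x} = ⊤) {V W : Type*}
    [AddCommGroup V] [Module F V] [AddCommGroup W] [Module F W] {ρ : Representation F G V}
    {σ : Representation F G W} {f : V →ₗ[F] W} (ha : ∀ v, f (ρ a v) = σ a (f v))
    (hx : ∀ v, f (ρ x v) = σ x (f v)) (g : G) : f ∘ₗ ρ g = σ g ∘ₗ f := by
  have hg : g ∈ Submonoid.closure {a, x} := h ▸ Submonoid.mem_top g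
  induction hg using Submonoid.closure_induction with
  | mem y hy =>
    rcases hy with rfl | rfl
    · exact LinearMap.ext ha
    · exact LinearMap.ext hx
  | one => ext; simp
  | mul y z _ _ hy hz =>
    rw [map_mul, map_mul, Module.End.mul_eq_comp, Module.End.mul_eq_comp, ← LinearMap.comp_assoc,
      hy, LinearMap.comp_assoc, hz, LinearMap.comp_assoc]

theorem mem_invariantForms_of_generators (h : Submonoid.closure {a, x} = ⊤) {V : Type*}
    [AddCommGroup V] [Module F V] {ρ : Representation F G V} {B : LinearMap.BilinForm F V}
    (ha : ∀ v w, B (ρ a v) (ρ a w) = B v w) (hx : ∀ v w, B (ρ x v) (ρ x w) = B v w) :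
    B ∈ invariantForms ρ := by
  intro g
  have hg : g ∈ Submonoid.closure {a, x} := h ▸ Submonoid.mem_top g
  induction hg using Submonoid.closure_induction with
  | mem y hy =>
    rcases hy with rfl | rfl
    · exact ha
    · exact hx
  | one => simp
  | mul y z _ _ hy hz => intro v w; rw [map_mul, Module.End.mul_apply, Module.End.mul_apply, hy, hz]

theorem apply_eq_smul_of_generators (h : Submonoid.closure {a, x} = ⊤) {V : Type*}
    [AddCommGroup V] [Module F V] {ρ : Representation F G V} {χ : G →* F} {v : V}
    (ha : ρ a v = χ a • v) (hx : ρ x v = χ x • v) (g : G) : ρ g v = χ g • v := by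
  have hg : g ∈ Submonoid.closure {a, x} := h ▸ Submonoid.mem_top g
  induction hg using Submonoid.closure_induction with
  | mem y hy =>
    rcases hy with rfl | rfl
    · exact ha
    · exact hx
  | one => simp
  | mul y z _ _ hy hz =>
    rw [map_mul, Module.End.mul_apply, hz, map_smul, hy, smul_smul, map_mul, mul_comm]

/-- A sign as an element of `F`. -/
def signCast (F : Type u) [Field F] : ℤˣ →* F := (Int.castRingHom F : ℤ →* F).comp (Units.coeHom ℤ)

theorem signCast_mul_self (s : ℤˣ) : signCast F s * signCast F s = 1 := by
  rw [← map_mul, Int.units_mul_self, map_one]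

theorem signCast_injective (h2 : (2 : F) ≠ 0) : Function.Injective (signCast F) := by
  have h : (1 : F) ≠ -1 := fun h => h2 (by linear_combination h)
  intro s t hst
  rcases Int.units_eq_one_or s with rfl | rfl <;> rcases Int.units_eq_one_or t with rfl | rfl
  · rfl
  · exact absurd (by simpa [signCast] using hst) h
  · exact absurd (by simpa [signCast] using hst.symm) h
  · rfl

/-- If `v + w` and `v - w` both vanished, so would `2v`. With `w = T v` for an involution `T`, this
yields an eigenvector. -/
theorem exists_add_signCast_smul_ne_zero (h2 : (2 : F) ≠ 0) {V : Type*} [AddCommGroup V]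
    [Module F V] {v : V} (hv : v ≠ 0) (w : V) : ∃ s : ℤˣ, v + signCast F s • w ≠ 0 := by
  by_contra! h
  have h1 := h 1
  have h3 := h (-1)
  simp only [signCast, MonoidHom.comp_apply, Units.coeHom_apply, Units.val_one, Units.val_neg,
    MonoidHom.coe_coe, map_neg, map_one, one_smul, neg_smul] at h1 h3
  have : (2 : F) • v = 0 := by
    rw [two_smul]
    calc v + v = (v + w) + (v + -w) := by abel
      _ = 0 := by rw [h1, h3, add_zero]
  exact (smul_ne_zero h2 hv) this

/-- A vector `v + s T v` is an eigenvector of the involution `T`. -/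
theorem apply_add_signCast_smul {V : Type*} [AddCommGroup V] [Module F V] {T : V →ₗ[F] V} {v : V}
    (hT : T (T v) = v) (s : ℤˣ) :
    T (v + signCast F s • T v) = signCast F s • (v + signCast F s • T v) := by
  rw [map_add, map_smul, hT, smul_add, smul_smul, signCast_mul_self, one_smul, add_comm]

theorem pow_apply_of_apply_eq_smul {V : Type*} [AddCommGroup V] [Module F V] {T : Module.End F V}
    {c : F} {v : V} (h : T v = c • v) (k : ℕ) : (T ^ k) v = c ^ k • v := by
  induction k with
  | zero => simp
  | succ k ih => rw [pow_succ, Module.End.mul_apply, h, map_smul, ih, smul_smul, ← pow_succ']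

/-- The diagonal endomorphism with entries `c` and `-c`. -/
def diagNeg (c : F) : Module.End F (Fin 2 → F) where
  toFun v := ![c * v 0, -c * v 1]
  map_add' v w := by ext i; fin_cases i <;> simp [mul_add]
  map_smul' k v := by ext i; fin_cases i <;> simp <;> ring

/-- The endomorphism `e₀ ↦ e₁ ↦ c e₀`. -/
def swapScaled (c : F) : Module.End F (Fin 2 → F) where
  toFun v := ![c * v 1, v 0]
  map_add' v w := by ext i; fin_cases i <;> simp [mul_add]
  map_smul' k v := by ext i; fin_cases i <;> simp; ring

@[simp] theorem diagNeg_apply (c : F) (v : Fin 2 → F) : diagNeg c v = ![c * v 0, -c * v 1] := rfl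

@[simp] theorem swapScaled_apply (c : F) (v : Fin 2 → F) : swapScaled c v = ![c * v 1, v 0] := rfl

theorem diagNeg_sq {c : F} (hc : c * c = -1) : diagNeg c ^ 2 = -1 := by
  rw [pow_two]
  refine LinearMap.ext fun v => funext fun i => ?_
  fin_cases i
  · simp; linear_combination v 0 * hc
  · simp; linear_combination v 1 * hc

/-! ### The four characters and the plane, and their completeness -/

namespace HasOrderEightPresentation

section Definitions

variable (hG : HasOrderEightPresentation.{u} a x e)
include hG

/-- Signs square to 1, so they satisfy the relations whatever `e` is: both groups have the same four
sign characters. -/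
theorem exists_character (p : ℤˣ × ℤˣ) :
    ∃ χ : G →* F, χ a = signCast F p.1 ∧ χ x = signCast F p.2 := by
  have h1 := signCast_mul_self (F := F) p.1
  refine hG.lift _ _ ?_ ?_ ?_
  · linear_combination (signCast F p.1 ^ 2 + 1) * h1
  · rw [signCast_mul_self, pow_mul, pow_two, h1, one_pow]
  · linear_combination (-signCast F p.1 * signCast F p.2) * h1

/-- The character with prescribed signs on the two generators. -/
noncomputable def character (F : Type u) [Field F] (p : ℤˣ × ℤˣ) : G →* F :=
  (hG.exists_character p).choose

theorem character_left (p : ℤˣ × ℤˣ) : hG.character F p a = signCast F p.1 :=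
  (hG.exists_character p).choose_spec.1

theorem character_right (p : ℤˣ × ℤˣ) : hG.character F p x = signCast F p.2 :=
  (hG.exists_character p).choose_spec.2

/-- The diagonal matrix squares to `-1` and the scaled swap to `(-1) ^ e`, so `X * X = A ^ (2 * e)`;
the swap exchanges the eigenlines for `c` and `-c`, which is the relation `A * X = X * A ^ 3`. -/
theorem exists_planeRep {c : F} (hc : c * c = -1) :
    ∃ ρ : Representation F G (Fin 2 → F), ρ a = diagNeg c ∧ ρ x = swapScaled ((-1) ^ e) := by
  have h2 := diagNeg_sq hc
  refine hG.lift _ _ ?_ ?_ ?_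
  · rw [show 4 = 2 * 2 from rfl, pow_mul, h2]
    exact neg_one_sq (R := Module.End F (Fin 2 → F))
  · rw [pow_mul, h2]
    refine LinearMap.ext fun v => funext fun i => ?_
    rw [pow_apply_of_apply_eq_smul (neg_one_smul F v).symm]
    fin_cases i <;> simp
  · rw [pow_succ, h2]
    refine LinearMap.ext fun v => funext fun i => ?_
    fin_cases i <;> simp; ring

/-- The two-dimensional irreducible representation. -/
noncomputable def planeRep {c : F} (hc : c * c = -1) : Representation F G (Fin 2 → F) :=
  (hG.exists_planeRep hc).choose

theorem planeRep_left {c : F} (hc : c * c = -1) : hG.planeRep hc a = diagNeg c :=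
  (hG.exists_planeRep hc).choose_spec.1

theorem planeRep_right {c : F} (hc : c * c = -1) :
    hG.planeRep hc x = swapScaled ((-1) ^ e) :=
  (hG.exists_planeRep hc).choose_spec.2

theorem character_mul_self (p : ℤˣ × ℤˣ) (g : G) :
    hG.character F p g * hG.character F p g = 1 := by
  have hg : g ∈ Submonoid.closure {a, x} := hG.closure_eq_top ▸ Submonoid.mem_top g
  induction hg using Submonoid.closure_induction with
  | mem y hy =>
    rcases hy with rfl | rfl
    · rw [hG.character_left, signCast_mul_self]
    · rw [hG.character_right, signCast_mul_self]
  | one => simp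
  | mul y z _ _ hy hz => rw [map_mul, mul_mul_mul_comm, hy, hz, one_mul]

theorem planeRep_isIrreducible (h2 : (2 : F) ≠ 0) {c : F} (hc : c * c = -1) :
    (hG.planeRep hc).IsIrreducible := by
  have hc0 : c ≠ 0 := fun h => by simp [h] at hc
  refine { exists_pair_ne := ⟨⊥, ⊤, fun h => ?_⟩, eq_bot_or_eq_top := fun N => ?_ }
  · exact bot_ne_top (α := Submodule F (Fin 2 → F)) (congrArg Subrepresentation.toSubmodule h)
  · have hswap : ∀ v ∈ N.toSubmodule, ![(-1) ^ e * v 1, v 0] ∈ N.toSubmodule := fun v hv => by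
      simpa [hG.planeRep_right] using N.apply_mem_toSubmodule x hv
    have key : ∀ v ∈ N.toSubmodule, v 0 ≠ 0 → N.toSubmodule = ⊤ := fun v hv hv0 => by
      have h1 := N.apply_mem_toSubmodule a hv
      rw [hG.planeRep_left] at h1
      -- The operator `a + c` kills the second coordinate and multiplies the first by `2 * c`, so it
      -- isolates the first basis vector.
      have h3 := N.toSubmodule.smul_mem (2 * c * v 0)⁻¹
        (N.toSubmodule.add_mem h1 (N.toSubmodule.smul_mem c hv))
      have h4 : (2 * c * v 0)⁻¹ • (diagNeg c v + c • v) = ![1, 0] := by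
        ext i
        fin_cases i
        · change (2 * c * v 0)⁻¹ * (c * v 0 + c * v 0) = 1
          field_simp; norm_num
        · change (2 * c * v 0)⁻¹ * (-c * v 1 + c * v 1) = 0
          ring
      rw [h4] at h3
      have h5 : ![0, 1] ∈ N.toSubmodule := by simpa using hswap _ h3
      rw [eq_top_iff]
      intro w _
      have : w = w 0 • ![1, 0] + w 1 • ![0, 1] := by ext i; fin_cases i <;> simp
      rw [this]
      exact add_mem (N.toSubmodule.smul_mem _ h3) (N.toSubmodule.smul_mem _ h5)
    rcases eq_or_ne N.toSubmodule ⊥ with h | h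
    · exact Or.inl (Subrepresentation.toSubmodule_injective h)
    · obtain ⟨v, hv, hv0⟩ := N.toSubmodule.exists_mem_ne_zero_of_ne_bot h
      refine Or.inr (Subrepresentation.toSubmodule_injective ?_)
      by_cases h0 : v 0 = 0
      -- When `v 0 = 0`, the swap brings the nonzero `v 1` into first position.
      · refine key _ (hswap v hv) ?_
        have h1 : v 1 ≠ 0 := fun h1 => hv0 (by ext i; fin_cases i <;> simp [h0, h1])
        simpa using h1
      · exact key v hv h0

/-- The form `v₀w₁ + (-1)^e v₁w₀` pairs the eigenlines of `a` with each other. It is invariant under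
`a` because `c * (-c) = 1`, and under `x` because the sign `(-1)^e` squares to 1. -/
theorem planeRep_admitsNondegenerateForm {c : F} (hc : c * c = -1) :
    AdmitsNondegenerateForm (hG.planeRep hc) := by
  have hs : ((-1 : F) ^ e) * (-1) ^ e = 1 := by rw [← mul_pow]; simp
  refine ⟨(LinearMap.mul F F).compl₁₂ (LinearMap.proj 0) (LinearMap.proj 1)
    + (-1 : F) ^ e • (LinearMap.mul F F).compl₁₂ (LinearMap.proj 1) (LinearMap.proj 0),
    mem_invariantForms_of_generators hG.closure_eq_top ?_ ?_, ?_, ?_⟩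
  · intro v w
    simp [hG.planeRep_left]
    linear_combination (-(v 0 * w 1) - (-1) ^ e * v 1 * w 0) * hc
  · intro v w
    simp [hG.planeRep_right]
    linear_combination (v 0 * w 1) * hs
  · intro v hv
    ext i
    fin_cases i
    · simpa using hv ![0, 1]
    · simpa using hv ![1, 0]
  · intro v hv
    ext i
    fin_cases i
    · simpa using hv ![0, 1]
    · simpa using hv ![1, 0]

/-- Every nonzero representation contains a character or the two-dimensional representation. -/
theorem exists_intertwiningMap_ne_zero (h2 : (2 : F) ≠ 0) {c : F} (hc : c * c = -1) {V : Type*}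
    [AddCommGroup V] [Module F V] [Nontrivial V] (ρ : Representation F G V) :
    (∃ p, ∃ f : IntertwiningMap (charRep (hG.character F p)) ρ, f ≠ 0) ∨
      ∃ f : IntertwiningMap (hG.planeRep hc) ρ, f ≠ 0 := by
  have hA4 : ∀ v, ρ a (ρ a (ρ a (ρ a v))) = v := fun v => by
    simp only [← Module.End.mul_apply, ← map_mul]
    rw [show a * (a * (a * a)) = a ^ 4 by simp only [pow_succ, pow_zero, one_mul, mul_assoc],
      hG.pow_four]
    simp
  have hXX : ∀ v, ρ x (ρ x v) = ((ρ a ^ 2) ^ e) v := fun v => by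
    rw [← Module.End.mul_apply, ← map_mul, hG.mul_self, map_pow, pow_mul]
  have hAX : ∀ v, ρ a (ρ x v) = ρ x (ρ a (ρ a (ρ a v))) := fun v => by
    simp only [← Module.End.mul_apply, ← map_mul]
    rw [hG.mul_eq]
    simp only [pow_succ, pow_zero, one_mul, mul_assoc]
  -- If `a ^ 2` acts trivially, `a` and `x` act as commuting involutions and share an eigenvector
  -- with signs as eigenvalues. Otherwise `a ^ 2` has eigenvalue `-1`, and the plane appears.
  by_cases hA2 : ∀ v, ρ a (ρ a v) = v
  · left
    have hA : ρ a ^ 2 = 1 := LinearMap.ext fun v => by rw [pow_two]; exact hA2 v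
    have hX2 : ∀ v, ρ x (ρ x v) = v := fun v => by rw [hXX, hA, one_pow]; rfl
    obtain ⟨v, hv⟩ := exists_ne (0 : V)
    obtain ⟨s, hs⟩ := exists_add_signCast_smul_ne_zero h2 hv (ρ a v)
    have hu := apply_add_signCast_smul (hA2 v) s
    generalize v + signCast F s • ρ a v = u at hs hu
    obtain ⟨t, ht⟩ := exists_add_signCast_smul_ne_zero h2 hs (ρ x u)
    refine ⟨(s, t), exists_charRep_intertwiningMap_ne_zero ρ _ ht
      (apply_eq_smul_of_generators hG.closure_eq_top ?_ ?_)⟩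
    · rw [hG.character_left, map_add, map_smul, hAX, hA2, hu, map_smul, smul_add,
        smul_comm (signCast F t)]
    · rw [hG.character_right, apply_add_signCast_smul (hX2 u)]
  · right
    push Not at hA2
    obtain ⟨v, hv⟩ := hA2
    obtain ⟨w, hw, hw2⟩ : ∃ w, w ≠ 0 ∧ ρ a (ρ a w) = -w :=
      ⟨v - ρ a (ρ a v), sub_ne_zero.2 hv.symm, by rw [map_sub, map_sub, hA4]; abel⟩
    -- As `(a - c)(a + c)` kills `w`, the vector `(a + c) w` serves if nonzero. Otherwise `w` has
    -- eigenvalue `-c`, and `x` carries it to eigenvalue `c`.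
    obtain ⟨u, hu, hau⟩ : ∃ u, u ≠ 0 ∧ ρ a u = c • u := by
      by_cases h : ρ a w + c • w = 0
      · refine ⟨ρ x w, fun h0 => hw ?_, ?_⟩
        · have h3 : ρ x⁻¹ (ρ x w) = w := by
            rw [← Module.End.mul_apply, ← map_mul, inv_mul_cancel, map_one]; rfl
          rw [← h3, h0, map_zero]
        · rw [hAX, hw2, map_neg, eq_neg_of_add_eq_zero_left h, neg_neg, map_smul]
      · refine ⟨_, h, ?_⟩
        rw [map_add, map_smul, hw2, smul_add, smul_smul, hc, neg_one_smul, add_comm]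
    have hAA : ρ a (ρ a u) = -u := by rw [hau, map_smul, hau, smul_smul, hc, neg_one_smul]
    have haxu : ρ a (ρ x u) = -c • ρ x u := by
      rw [hAX, hAA, map_neg, map_neg, hau, map_smul, neg_smul]
    have hxxu : ρ x (ρ x u) = (-1 : F) ^ e • u := by
      rw [hXX, pow_apply_of_apply_eq_smul]
      rw [pow_two, Module.End.mul_apply, hAA, neg_one_smul]
    -- The basis vectors of the plane go to `u` and `x u`, eigenvectors of `a` for `c` and `-c`.
    refine ⟨⟨(LinearMap.proj 0).smulRight u + (LinearMap.proj 1).smulRight (ρ x u),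
      isIntertwining_of_generators hG.closure_eq_top ?_ ?_⟩, fun hf => ?_⟩
    · intro y
      simp [hG.planeRep_left, hau, haxu, smul_smul, mul_comm]
    · intro y
      simp [hG.planeRep_right, hxxu, smul_smul, mul_comm, add_comm]
    · have := DFunLike.congr_fun hf ![1, 0]
      exact hu (by simpa using this)

end Definitions

end HasOrderEightPresentation

/-- The degrees of the irreducible representations in the order eight non-commutative case. -/
def orderEightDegree : Option (ℤˣ × ℤˣ) → ℕ
  | none => 2
  | some _ => 1

namespace HasOrderEightPresentation

/-- The irreducible representations. -/
noncomputable def irreducible (hG : HasOrderEightPresentation.{u} a x e) {c : F}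
    (hc : c * c = -1) : ∀ i, Representation F G (Fin (orderEightDegree i) → F)
  | none => hG.planeRep hc
  | some p => charRep (hG.character F p)

theorem isCompleteIrreducible (hG : HasOrderEightPresentation.{u} a x e) (h2 : (2 : F) ≠ 0) {c : F}
    (hc : c * c = -1) : IsCompleteIrreducible (hG.irreducible hc) where
  irreducible
    | none => hG.planeRep_isIrreducible h2 hc
    | some p => charRep_isIrreducible _
  eq_of_equiv i j := fun ⟨f⟩ => by
    have hd := f.toLinearEquiv.finrank_eq
    rw [Module.finrank_fin_fun, Module.finrank_fin_fun] at hd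
    -- Mixed cases are excluded by the degrees 2 and 1; characters are separated by their signs on
    -- `a` and `x`.
    match i, j, f, hd with
    | none, none, _, _ => rfl
    | some p, some q, f, _ =>
      have h := eq_of_charRep_equiv f
      have ha := DFunLike.congr_fun h a
      have hx := DFunLike.congr_fun h x
      rw [hG.character_left, hG.character_left] at ha
      rw [hG.character_right, hG.character_right] at hx
      exact congrArg some (Prod.ext (signCast_injective h2 ha) (signCast_injective h2 hx))
  exists_ne_zero V _ _ _ _ ρ := by
    rcases hG.exists_intertwiningMap_ne_zero h2 hc ρ with ⟨p, hp⟩ | h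
    · exact ⟨some p, hp⟩
    · exact ⟨none, h⟩

theorem irreducible_admitsNondegenerateForm (hG : HasOrderEightPresentation.{u} a x e) {c : F}
    (hc : c * c = -1) : ∀ i, AdmitsNondegenerateForm (hG.irreducible hc i)
  | none => hG.planeRep_admitsNondegenerateForm hc
  | some p => charRep_admitsNondegenerateForm (hG.character_mul_self p)

end HasOrderEightPresentation

/-- Fibre over the multiplicity `s ≤ n / 2` of the plane; stars and bars on the four characters
counts each fibre. -/
theorem natCard_orderEight_multiplicities (n : ℕ) :
    Nat.card {m : Option (ℤˣ × ℤˣ) → ℕ // ∑ i, m i * orderEightDegree i = n}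
      = ∑ s ∈ Finset.range (n / 2 + 1), (n - 2 * s + 3).choose 3 := by
  have hsum : ∀ m : Option (ℤˣ × ℤˣ) → ℕ,
      ∑ i, m i * orderEightDegree i = m none * 2 + ∑ p, m (some p) := fun m => by
    simp [Fintype.sum_option, orderEightDegree]
  let E : {m : Option (ℤˣ × ℤˣ) → ℕ // ∑ i, m i * orderEightDegree i = n} ≃
      Σ s : Fin (n / 2 + 1), {m : ℤˣ × ℤˣ → ℕ // ∑ p, m p = n - 2 * s} :=
    { toFun m := ⟨⟨m.1 none, by have := hsum m.1; have := m.2; omega⟩,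
        fun p => m.1 (some p), by have := hsum m.1; have := m.2; simp only; omega⟩
      invFun q := ⟨fun i => i.elim q.1 q.2.1, by
        have h1 := q.2.2; have := q.1.2
        rw [hsum]; simp only [Option.elim_none, Option.elim_some, h1]; omega⟩
      left_inv m := Subtype.ext (funext fun | none => rfl | some _ => rfl)
      right_inv _ := rfl }
  have hfin (k : ℕ) : Finite {m : ℤˣ × ℤˣ → ℕ // ∑ p, m p = k} :=
    Finite.of_equiv _ (Sym.equivNatSumOfFintype (ℤˣ × ℤˣ) k)
  rw [Nat.card_congr E, Nat.card_sigma, Finset.sum_range]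
  refine Finset.sum_congr rfl fun s _ => ?_
  rw [natCard_sum_eq, show Fintype.card (ℤˣ × ℤˣ) = 4 from rfl,
    show 4 + (n - 2 * (s : ℕ)) - 1 = n - 2 * s + 3 by omega, Nat.choose_symm_add]

theorem HasOrderEightPresentation.natCard_eq [IsAlgClosed F] [Finite G]
    (hG : HasOrderEightPresentation.{u} a x e) (hcard : Nat.card G = 8) (h2 : (2 : F) ≠ 0) (n : ℕ) :
    Nat.card {c : RepClass F G n // c.AdmitsNondegenerateForm}
        = ∑ s ∈ Finset.range (n / 2 + 1), (n - 2 * s + 3).choose 3 ∧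
      Nat.card {c : RepClass F G n // c.AdmitsNondegenerateForm} = Nat.card (RepClass F G n) := by
  have : NeZero (Nat.card G : F) := ⟨by
    rw [hcard, show ((8 : ℕ) : F) = 2 ^ 3 by norm_num]; exact pow_ne_zero 3 h2⟩
  -- A square root of `-1` is the eigenvalue of `a` needed to define the plane.
  obtain ⟨c, hc⟩ := IsAlgClosed.exists_eq_mul_self (-1 : F)
  have hS := hG.isCompleteIrreducible h2 hc.symm
  have h := hS.natCard_admitsNondegenerateForm (hG.irreducible_admitsNondegenerateForm hc.symm) n
  refine ⟨?_, h⟩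
  rw [h, hS.natCard_repClass, natCard_orderEight_multiplicities]

end OrderEight

theorem mainTheorem8 (F : Type u) [Field F] [IsAlgClosed F] (hF : ringChar F ≠ 2) (n : ℕ) :
    (Nat.card {c : RepClass F (DihedralGroup 4) n // c.AdmitsNondegenerateForm}
        = ∑ s ∈ Finset.range (n / 2 + 1), (n - 2 * s + 3).choose 3 ∧
      Nat.card {c : RepClass F (DihedralGroup 4) n // c.AdmitsNondegenerateForm}
        = Nat.card (RepClass F (DihedralGroup 4) n)) ∧
    (Nat.card {c : RepClass F (QuaternionGroup 2) n // c.AdmitsNondegenerateForm}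
        = ∑ s ∈ Finset.range (n / 2 + 1), (n - 2 * s + 3).choose 3 ∧
      Nat.card {c : RepClass F (QuaternionGroup 2) n // c.AdmitsNondegenerateForm}
        = Nat.card (RepClass F (QuaternionGroup 2) n)) ∧
    (Nat.card {c : RepClass F (Multiplicative (ZMod 2 × ZMod 2 × ZMod 2)) n //
          c.AdmitsNondegenerateForm}
        = (n + 7).choose 7 ∧
      Nat.card {c : RepClass F (Multiplicative (ZMod 2 × ZMod 2 × ZMod 2)) n //
          c.AdmitsNondegenerateForm}
        = Nat.card (RepClass F (Multiplicative (ZMod 2 × ZMod 2 × ZMod 2)) n)) := by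
  have h2 : (2 : F) ≠ 0 := Ring.two_ne_zero hF
  have hcard : Nat.card (Multiplicative (ZMod 2 × ZMod 2 × ZMod 2)) = 8 := by
    rw [Nat.card_eq_fintype_card]; rfl
  have : NeZero (Nat.card (Multiplicative (ZMod 2 × ZMod 2 × ZMod 2)) : F) := ⟨by
    rw [hcard, show ((8 : ℕ) : F) = 2 ^ 3 by norm_num]; exact pow_ne_zero 3 h2⟩
  have h := natCard_admitsNondegenerateForm_of_sq_eq_one (F := F)
    (G := Multiplicative (ZMod 2 × ZMod 2 × ZMod 2)) (by decide) n
  refine ⟨hasOrderEightPresentation_dihedralGroup.natCard_eq ?_ h2 n,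
    hasOrderEightPresentation_quaternionGroup.natCard_eq ?_ h2 n, ?_, h⟩
  · rw [Nat.card_eq_fintype_card, DihedralGroup.card]
  · rw [Nat.card_eq_fintype_card, QuaternionGroup.card]
  · rw [h, natCard_repClass_of_commGroup, hcard, show 8 + n - 1 = n + 7 by omega,
      Nat.choose_symm_add]
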